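/- Let $p \ge 2$ be a real number. A function $\eta$ is called a modulus of uniform convexity for a (real or complex) Banach space $\mathbb{B}$ if for every $\varepsilon \in (0,2]$ we have $\eta(\varepsilon) \in (0,1]$, and $\|(x+y)/2\| \le 1 - \eta(\varepsilon)$ whenever $x, y \in \mathbb{B}$ satisfy $\|x\| \le 1$, $\|y\| \le 1$ and $\|x-y\| \ge \varepsilon$; $\mathbb{B}$ is called $p$-uniformly convex if $\eta(\varepsilon) = K\varepsilon^p$ is a modulus of uniform convexity for $\mathbb{B}$ for some $K > 0$. Let $\mathbb{B}$ be a $p$-uniformly convex Banach space and let $T$ be a linear operator on $\mathbb{B}$ satisfying $B_1\|y\| \le \|T^n y\| \le B_2\|y\|$ for every $n \in \mathbb{N}$ and every $y \in \mathbb{B}$, for some $B_1, B_2 > 0$. For $n \ge 1$ let $A_n x = \frac1n \sum_{i<n} T^i x$. Then for every $x \in \mathbb{B}$ and every increasing (not necessarily strictly) sequence $(t_k)_{k \in \mathbb{N}}$ of positive integers, $$\sum_{k} \|A_{t_{k+1}} x - A_{t_k} x\|^p \le C \|x\|^p$$ for some constant $C$ (in particular the series converges). If $\eta(\varepsilon)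 = K\varepsilon^p$ is a modulus of uniform convexity for $\mathbb{B}$, the constant $C$ depends only on $B_1$, $B_2$, $K$ and $p$; it does not depend on $\mathbb{B}$, $T$, $x$ or $(t_k)$. -/

import Mathlib

/-- `η` is a modulus of uniform convexity for the normed space `B`: for every `ε ∈ (0, 2]`, the
number `η ε` lies in `(0, 1]`, and any two points of the closed unit ball at distance at least `ε`
have a midpoint of norm at most `1 - η ε`. The values of `η` outside `(0, 2]` play no role. -/
def IsModulusOfUniformConvexity (𝕜 B : Type*) [RCLike 𝕜] [NormedAddCommGroup B] [NormedSpace 𝕜 B]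
    (η : ℝ → ℝ) : Prop :=
  ∀ ε : ℝ, 0 < ε → ε ≤ 2 → 0 < η ε ∧ η ε ≤ 1 ∧
    ∀ x y : B, ‖x‖ ≤ 1 → ‖y‖ ≤ 1 → ε ≤ ‖x - y‖ → ‖(2⁻¹ : 𝕜) • (x + y)‖ ≤ 1 - η ε

/-- The ergodic average `A_n x = (1/n) ∑_{i < n} T^i x` of a linear operator `T`
(meaningful for `n ≥ 1`). -/
noncomputable def ergodicAverage {𝕜 B : Type*} [RCLike 𝕜] [NormedAddCommGroup B] [NormedSpace 𝕜 B]
    (T : B →ₗ[𝕜] B) (n : ℕ) (x : B) : B :=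
  (n : 𝕜)⁻¹ • ∑ i ∈ Finset.range n, (T ^ i) x

/-! Uniform convexity upgrades to the homogeneous inequality `‖(u + v) / 2‖ ^ p + c ‖u - v‖ ^ p ≤
(‖u‖ ^ p + ‖v‖ ^ p) / 2` (`norm_rpow_midpoint_add_le`). This form survives averaging over orbits, so
a Banach limit of `p`-th power means gives an equivalent seminorm `N` with the same inequality for
which `T` is an isometry (`exists_invariant_seminorm`).

Write `D n` for the average of length `2 ^ n`. Since `D (n + 1)` is the midpoint of `D n` and `T ^
(2 ^ n) (D n)`, the energy `N (D n) ^ p` drops by at least `c δ_n ^ p`, where `δ_n = N (D n - D (n +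
1))`; hence `∑ δ_n ^ p ≤ N x ^ p / c`. The smoothed increments `G_n` are then also `p`-summable.

Inside a block `2 ^ (m - 1) ≤ s ≤ t ≤ 2 ^ m` one has `N (A_t x - A_s x) ≤ 92 √((t - s) / 2 ^ m)
G_m`. As `p ≥ 2`, the `p`-th power is at most a constant times `(t - s) G_m ^ p / 2 ^ m`, which is
additive in the interval (`ergodicAverage_sub_rpow_le_of_block`). Between dyadic times, Jensen's
inequality with a convexity defect bounds `N (D i - D j) ^ p` by the energy drop plus `G_j ^ p`
(`dyadicAverage_sub_rpow_le`).

So each term of the variation sum is at most the increment of one function of time, a combination of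
the clock and the energy (`ergodicAverage_sub_rpow_le`). The sum telescopes for every monotone
sequence of times. -/

theorem clarkson_real {p a b : ℝ} (hp : 2 ≤ p) (hb : 0 ≤ b) (hab : b ≤ a) :
    ((a + b) / 2) ^ p + ((a - b) / 2) ^ p ≤ (a ^ p + b ^ p) / 2 := by
  have key : ∀ z : ℝ, 0 ≤ z → z ^ p = (z ^ 2) ^ (p / 2) := fun z hz => by
    rw [← Real.rpow_natCast_mul hz]
    congr 1
    push_cast
    ring
  -- With exponent `p / 2 ≥ 1` on squares: superadditivity, then the parallelogram identity, then
  -- convexity.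
  have h1 : (((a + b) / 2) ^ 2) ^ (p / 2) + (((a - b) / 2) ^ 2) ^ (p / 2)
      ≤ (((a + b) / 2) ^ 2 + ((a - b) / 2) ^ 2) ^ (p / 2) :=
    Real.add_rpow_le_rpow_add (sq_nonneg _) (sq_nonneg _) (by linarith)
  have h2 := (convexOn_rpow (p := p / 2) (by linarith)).2 (Set.mem_Ici.2 (sq_nonneg a))
    (Set.mem_Ici.2 (sq_nonneg b)) (by norm_num : (0 : ℝ) ≤ 1 / 2) (by norm_num : (0 : ℝ) ≤ 1 / 2)
    (by norm_num)
  simp only [smul_eq_mul] at h2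
  rw [key _ (by linarith), key ((a - b) / 2) (by linarith), key a (by linarith), key b hb]
  calc _ ≤ _ := h1
    _ = (1 / 2 * a ^ 2 + 1 / 2 * b ^ 2) ^ (p / 2) := by congr 1; ring
    _ ≤ _ := h2
    _ = _ := by ring

/-! ### The `p`-th power midpoint inequality. -/

section UniformConvexity

variable {E : Type*} [NormedAddCommGroup E] [NormedSpace ℝ E] {p K : ℝ}

theorem IsModulusOfUniformConvexity.constant_pos
    (hη : IsModulusOfUniformConvexity ℝ E (fun ε => K * ε ^ p)) : 0 < K := by
  have h := (hη 1 one_pos one_le_two).1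
  simpa using h

theorem IsModulusOfUniformConvexity.norm_midpoint_le
    (hη : IsModulusOfUniformConvexity ℝ E (fun ε => K * ε ^ p)) {x y : E}
    (hx : ‖x‖ = 1) (hy : ‖y‖ = 1) (hxy : x ≠ y) :
    ‖(2⁻¹ : ℝ) • (x + y)‖ ≤ 1 - K * ‖x - y‖ ^ p := by
  have h0 : 0 < ‖x - y‖ := norm_pos_iff.2 (sub_ne_zero.2 hxy)
  have h2 : ‖x - y‖ ≤ 2 := (norm_sub_le x y).trans (by linarith)
  exact (hη _ h0 h2).2.2 x y hx.le hy.le le_rfl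

/-- The constant in the `p`-th power form of `p`-uniform convexity with modulus `K * ε ^ p`. -/
noncomputable def uniformConvexityConstant (p K : ℝ) : ℝ :=
  min ((8 : ℝ) ^ (-p)) (K / 2 * (4 : ℝ) ^ (-p))

theorem uniformConvexityConstant_pos (hK : 0 < K) : 0 < uniformConvexityConstant p K := by
  unfold uniformConvexityConstant
  positivity

/-- Two sources of defect compete. If `‖v‖` is well below `1`, the scalar inequality `clarkson_real`
already leaves `((1 - ‖v‖) / 2) ^ p` to spare. Otherwise `v` is close to its normalization `w`, and
uniform convexity on the unit sphere applies to `u` and `w`. -/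
theorem norm_rpow_midpoint_add_le_of_norm_eq_one (hp : 2 ≤ p)
    (hη : IsModulusOfUniformConvexity ℝ E (fun ε => K * ε ^ p)) {u v : E}
    (hu : ‖u‖ = 1) (hv : ‖v‖ ≤ 1) :
    ‖(2⁻¹ : ℝ) • (u + v)‖ ^ p + uniformConvexityConstant p K * ‖u - v‖ ^ p
      ≤ (1 + ‖v‖ ^ p) / 2 := by
  have hK := hη.constant_pos
  have hcl := clarkson_real hp (norm_nonneg v) hv
  rw [Real.one_rpow] at hcl
  have hd0 := norm_nonneg (u - v)
  have hd2 : ‖u - v‖ ≤ 2 := (norm_sub_le u v).trans (by linarith)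
  have hmM : ‖(2⁻¹ : ℝ) • (u + v)‖ ≤ (1 + ‖v‖) / 2 := by
    rw [norm_smul, Real.norm_of_nonneg (by norm_num)]
    linarith [norm_add_le u v]
  have hv0 := norm_nonneg v
  by_cases hcase : ‖u - v‖ / 4 ≤ 1 - ‖v‖
  · have h1 : ‖(2⁻¹ : ℝ) • (u + v)‖ ^ p ≤ ((1 + ‖v‖) / 2) ^ p :=
      Real.rpow_le_rpow (norm_nonneg _) hmM (by linarith)
    have h2 : uniformConvexityConstant p K * ‖u - v‖ ^ p ≤ ((1 - ‖v‖) / 2) ^ p := by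
      calc uniformConvexityConstant p K * ‖u - v‖ ^ p ≤ (8 : ℝ) ^ (-p) * ‖u - v‖ ^ p := by
            gcongr
            exact min_le_left _ _
        _ = (‖u - v‖ / 8) ^ p := by
            rw [Real.div_rpow hd0 (by norm_num), Real.rpow_neg (by norm_num)]
            field_simp
        _ ≤ _ := Real.rpow_le_rpow (by positivity) (by linarith) (by linarith)
    linarith
  · push Not at hcase
    -- From `1 - ‖v‖ < ‖u - v‖ / 4` and `‖u - v‖ ≤ 2`.
    have hs : 1 / 2 < ‖v‖ := by linarith
    have hvpos : 0 < ‖v‖ := by linarith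
    set w : E := ‖v‖⁻¹ • v with hw
    have hwn : ‖w‖ = 1 := by
      rw [hw, norm_smul, norm_inv, norm_norm, inv_mul_cancel₀ hvpos.ne']
    have hvw : v = ‖v‖ • w := by
      rw [hw, smul_smul, mul_inv_cancel₀ hvpos.ne', one_smul]
    have hdist : ‖u - v‖ / 2 ≤ ‖u - w‖ := by
      have h1 : u - v = (u - w) + (1 - ‖v‖) • w := by
        nth_rewrite 1 [hvw]
        module
      have h2 : ‖u - v‖ ≤ ‖u - w‖ + (1 - ‖v‖) := by
        calc ‖u - v‖ = ‖(u - w) + (1 - ‖v‖) • w‖ := by rw [← h1]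
          _ ≤ ‖u - w‖ + ‖(1 - ‖v‖) • w‖ := norm_add_le _ _
          _ = _ := by rw [norm_smul, hwn, Real.norm_of_nonneg (by linarith), mul_one]
      linarith
    have hdpos : 0 < ‖u - v‖ := by linarith
    have huw : u ≠ w := by
      rintro rfl
      rw [sub_self, norm_zero] at hdist
      linarith
    have hmid := hη.norm_midpoint_le hu hwn huw
    have hpow : ((1 / 2 : ℝ)) ^ p * ‖u - v‖ ^ p ≤ ‖u - w‖ ^ p := by
      rw [← Real.mul_rpow (by norm_num) hd0]
      exact Real.rpow_le_rpow (by positivity) (by linarith) (by linarith)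
    set m := ‖(2⁻¹ : ℝ) • (u + v)‖ with hm
    set M := (1 + ‖v‖) / 2 with hM
    have hm0 : 0 ≤ m := norm_nonneg _
    have hm1 : m ≤ M - ‖v‖ * (K * ‖u - w‖ ^ p) := by
      -- The midpoint splits into a multiple of the unit-sphere midpoint and a leftover along `u`,
      -- so the defect is only scaled by `‖v‖`.
      have h1 : (2⁻¹ : ℝ) • (u + v) = ‖v‖ • ((2⁻¹ : ℝ) • (u + w)) + ((1 - ‖v‖) / 2) • u := by
        nth_rewrite 1 [hvw]
        module
      calc m ≤ ‖‖v‖ • ((2⁻¹ : ℝ) • (u + w))‖ + ‖((1 - ‖v‖) / 2) • u‖ := by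
            rw [hm, h1]; exact norm_add_le _ _
        _ = ‖v‖ * ‖(2⁻¹ : ℝ) • (u + w)‖ + (1 - ‖v‖) / 2 := by
            rw [norm_smul, norm_smul _ u, hu, norm_norm,
              Real.norm_of_nonneg (by linarith : 0 ≤ (1 - ‖v‖) / 2), mul_one]
        _ ≤ ‖v‖ * (1 - K * ‖u - w‖ ^ p) + (1 - ‖v‖) / 2 := by gcongr
        _ = _ := by rw [hM]; ring
    have hgap : K / 2 * ((1 / 2 : ℝ) ^ p * ‖u - v‖ ^ p) ≤ M - m := by
      have h3 : K / 2 * ((1 / 2 : ℝ) ^ p * ‖u - v‖ ^ p) ≤ ‖v‖ * (K * ‖u - w‖ ^ p) := by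
        calc K / 2 * ((1 / 2 : ℝ) ^ p * ‖u - v‖ ^ p) ≤ K / 2 * ‖u - w‖ ^ p := by gcongr
          _ = 1 / 2 * (K * ‖u - w‖ ^ p) := by ring
          _ ≤ _ := by gcongr
      linarith
    have hM0 : 1 / 2 ≤ M := by rw [hM]; linarith
    have hMp : ((1 / 2 : ℝ)) ^ p ≤ M ^ (p - 1) := by
      calc ((1 / 2 : ℝ)) ^ p ≤ (1 / 2 : ℝ) ^ (p - 1) :=
            Real.rpow_le_rpow_of_exponent_ge (by norm_num) (by norm_num) (by linarith)
        _ ≤ _ := Real.rpow_le_rpow (by norm_num) hM0 (by linarith)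
    have hpp : M ^ (p - 1) * (M - m) ≤ M ^ p - m ^ p := by
      have e1 : ∀ z : ℝ, 0 ≤ z → z ^ p = z ^ (p - 1) * z := fun z hz => by
        nth_rewrite 3 [← Real.rpow_one z]
        rw [← Real.rpow_add_of_nonneg hz (by linarith) (by norm_num)]
        congr 1
        ring
      rw [e1 M (by linarith), e1 m hm0]
      have : m ^ (p - 1) * m ≤ M ^ (p - 1) * m :=
        mul_le_mul_of_nonneg_right (Real.rpow_le_rpow hm0 hmM (by linarith)) hm0
      linarith
    have hfin : uniformConvexityConstant p K * ‖u - v‖ ^ p ≤ M ^ p - m ^ p := by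
      refine le_trans ?_ hpp
      calc uniformConvexityConstant p K * ‖u - v‖ ^ p
          ≤ (K / 2 * (4 : ℝ) ^ (-p)) * ‖u - v‖ ^ p := by
            gcongr
            exact min_le_right _ _
        _ = (1 / 2 : ℝ) ^ p * (K / 2 * ((1 / 2 : ℝ) ^ p * ‖u - v‖ ^ p)) := by
            have : (4 : ℝ) ^ (-p) = (1 / 2 : ℝ) ^ p * (1 / 2 : ℝ) ^ p := by
              rw [← Real.mul_rpow (by norm_num) (by norm_num), Real.rpow_neg (by norm_num),
                ← Real.inv_rpow (by norm_num)]
              norm_num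
            rw [this]; ring
        _ ≤ _ := by gcongr
    have h6 : 0 ≤ ((1 - ‖v‖) / 2) ^ p := Real.rpow_nonneg (by linarith) _
    linarith

theorem norm_rpow_midpoint_add_le (hp : 2 ≤ p)
    (hη : IsModulusOfUniformConvexity ℝ E (fun ε => K * ε ^ p)) (u v : E) :
    ‖(2⁻¹ : ℝ) • (u + v)‖ ^ p + uniformConvexityConstant p K * ‖u - v‖ ^ p
      ≤ (‖u‖ ^ p + ‖v‖ ^ p) / 2 := by
  wlog huv : ‖v‖ ≤ ‖u‖ generalizing u v
  · have := this v u (by linarith)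
    rwa [add_comm v u, norm_sub_rev, add_comm (‖v‖ ^ p)] at this
  rcases eq_or_ne u 0 with rfl | hu
  · have hv : v = 0 := by simpa using huv
    subst hv
    simp [Real.zero_rpow (by linarith : p ≠ 0)]
  have hu0 : 0 < ‖u‖ := norm_pos_iff.2 hu
  have hsc : ∀ z : E, ‖z‖ = ‖u‖ * ‖‖u‖⁻¹ • z‖ := fun z => by
    rw [norm_smul, norm_inv, norm_norm, mul_inv_cancel_left₀ hu0.ne']
  have hsp : ∀ z : E, ‖z‖ ^ p = ‖u‖ ^ p * ‖‖u‖⁻¹ • z‖ ^ p := fun z => by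
    rw [← Real.mul_rpow (norm_nonneg _) (norm_nonneg _), ← hsc]
  have h1 : ‖‖u‖⁻¹ • u‖ = 1 := by
    rw [norm_smul, norm_inv, norm_norm, inv_mul_cancel₀ hu0.ne']
  have h2 : ‖‖u‖⁻¹ • v‖ ≤ 1 := by
    rw [norm_smul, norm_inv, norm_norm, inv_mul_le_iff₀ hu0, mul_one]
    exact huv
  have h3 := norm_rpow_midpoint_add_le_of_norm_eq_one hp hη h1 h2
  rw [← smul_add, ← smul_sub, smul_comm] at h3
  rw [hsp ((2⁻¹ : ℝ) • (u + v)), hsp (u - v), hsp v]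
  have h4 : 0 ≤ ‖u‖ ^ p := by positivity
  nlinarith [mul_le_mul_of_nonneg_left h3 h4]

end UniformConvexity

/-! ### Renorming so that `T` becomes an isometry. -/

section InvariantSeminorm

open Filter Topology

variable {E : Type*} [NormedAddCommGroup E] [NormedSpace ℝ E] {p B₁ B₂ : ℝ}

/-- The average of `‖T ^ j y‖ ^ p` over `j ≤ n`. -/
noncomputable def orbitMean (T : E →ₗ[ℝ] E) (p : ℝ) (n : ℕ) (y : E) : ℝ :=
  (∑ j ∈ Finset.range (n + 1), ‖(T ^ j) y‖ ^ p) / (n + 1)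

theorem orbitMean_nonneg (T : E →ₗ[ℝ] E) (n : ℕ) (y : E) : 0 ≤ orbitMean T p n y := by
  unfold orbitMean
  positivity

theorem le_orbitMean (T : E →ₗ[ℝ] E) (n : ℕ) (y : E) {b : ℝ} (h : ∀ j, b ≤ ‖(T ^ j) y‖ ^ p) :
    b ≤ orbitMean T p n y := by
  rw [orbitMean, le_div_iff₀ (by positivity)]
  have := Finset.card_nsmul_le_sum (Finset.range (n + 1)) (fun j => ‖(T ^ j) y‖ ^ p) b
    (fun j _ => h j)
  simpa [mul_comm] using this

theorem orbitMean_le (T : E →ₗ[ℝ] E) (n : ℕ) (y : E) {b : ℝ} (h : ∀ j, ‖(T ^ j) y‖ ^ p ≤ b) :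
    orbitMean T p n y ≤ b := by
  rw [orbitMean, div_le_iff₀ (by positivity)]
  have := Finset.sum_le_card_nsmul (Finset.range (n + 1)) (fun j => ‖(T ^ j) y‖ ^ p) b
    (fun j _ => h j)
  simpa [mul_comm] using this

theorem orbitMean_map_sub (T : E →ₗ[ℝ] E) (n : ℕ) (y : E) :
    orbitMean T p n (T y) - orbitMean T p n y
      = (‖(T ^ (n + 1)) y‖ ^ p - ‖y‖ ^ p) / (n + 1) := by
  have h1 : ∀ j, (T ^ j) (T y) = (T ^ (j + 1)) y := fun j => by
    rw [pow_succ, Module.End.mul_apply]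
  rw [orbitMean, orbitMean, ← sub_div]
  simp only [h1]
  have h2 := Finset.sum_range_succ (fun j => ‖(T ^ j) y‖ ^ p) (n + 1)
  have h3 := Finset.sum_range_succ' (fun j => ‖(T ^ j) y‖ ^ p) (n + 1)
  rw [h2] at h3
  simp only [pow_zero, Module.End.one_apply] at h3
  congr 1
  linarith

theorem orbitMean_midpoint_add_le {c : ℝ} (T : E →ₗ[ℝ] E)
    (h : ∀ u v : E, ‖(2⁻¹ : ℝ) • (u + v)‖ ^ p + c * ‖u - v‖ ^ p ≤ (‖u‖ ^ p + ‖v‖ ^ p) / 2)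
    (n : ℕ) (u v : E) :
    orbitMean T p n ((2⁻¹ : ℝ) • (u + v)) + c * orbitMean T p n (u - v)
      ≤ (orbitMean T p n u + orbitMean T p n v) / 2 := by
  have h1 := Finset.sum_le_sum (s := Finset.range (n + 1))
    (fun j _ => h ((T ^ j) u) ((T ^ j) v))
  rw [Finset.sum_add_distrib, ← Finset.mul_sum, ← Finset.sum_div, Finset.sum_add_distrib] at h1
  simp only [← map_add, ← map_sub, ← map_smul] at h1
  have hn : (0 : ℝ) < n + 1 := by positivity
  have h2 := div_le_div_of_nonneg_right h1 hn.le
  unfold orbitMean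
  refine le_trans (le_of_eq ?_) (h2.trans (le_of_eq ?_)) <;> ring

theorem orbitMean_smul (T : E →ₗ[ℝ] E) (n : ℕ) (r : ℝ) (y : E) :
    orbitMean T p n (r • y) = ‖r‖ ^ p * orbitMean T p n y := by
  unfold orbitMean
  simp only [map_smul, norm_smul, Real.mul_rpow (norm_nonneg _) (norm_nonneg _)]
  rw [← Finset.mul_sum, mul_div_assoc]

theorem orbitMean_rpow_add_le (hp : 1 ≤ p) (T : E →ₗ[ℝ] E) (n : ℕ) (u v : E) :
    orbitMean T p n (u + v) ^ (1 / p)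
      ≤ orbitMean T p n u ^ (1 / p) + orbitMean T p n v ^ (1 / p) := by
  have h1 := Real.Lp_add_le_of_nonneg (s := Finset.range (n + 1)) (p := p)
    (f := fun j => ‖(T ^ j) u‖) (g := fun j => ‖(T ^ j) v‖) hp
    (fun _ _ => norm_nonneg _) (fun _ _ => norm_nonneg _)
  have h2 : (∑ j ∈ Finset.range (n + 1), ‖(T ^ j) (u + v)‖ ^ p) ^ (1 / p)
      ≤ (∑ j ∈ Finset.range (n + 1), (‖(T ^ j) u‖ + ‖(T ^ j) v‖) ^ p) ^ (1 / p) := by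
    refine Real.rpow_le_rpow (by positivity) (Finset.sum_le_sum fun j _ => ?_) (by positivity)
    rw [map_add]
    exact Real.rpow_le_rpow (norm_nonneg _) (norm_add_le _ _) (by linarith)
  unfold orbitMean
  rw [Real.div_rpow (by positivity) (by positivity), Real.div_rpow (by positivity) (by positivity),
    Real.div_rpow (by positivity) (by positivity), ← add_div]
  exact div_le_div_of_nonneg_right (h2.trans h1) (by positivity)

/-- A linear operator whose powers are uniformly bounded above and below is an isometry for an
equivalent seminorm, which inherits every `p`-th power midpoint inequality of the norm. -/
theorem exists_invariant_seminorm (hp : 1 ≤ p) (hB₁ : 0 < B₁) (T : E →ₗ[ℝ] E)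
    (hT : ∀ (n : ℕ) (y : E), B₁ * ‖y‖ ≤ ‖(T ^ n) y‖ ∧ ‖(T ^ n) y‖ ≤ B₂ * ‖y‖) :
    ∃ N : Seminorm ℝ E, (∀ y, N (T y) = N y) ∧ (∀ y, B₁ * ‖y‖ ≤ N y ∧ N y ≤ B₂ * ‖y‖) ∧
      ∀ c : ℝ, (∀ u v : E, ‖(2⁻¹ : ℝ) • (u + v)‖ ^ p + c * ‖u - v‖ ^ p
          ≤ (‖u‖ ^ p + ‖v‖ ^ p) / 2) →
        ∀ u v : E, N ((2⁻¹ : ℝ) • (u + v)) ^ p + c * N (u - v) ^ p ≤ (N u ^ p + N v ^ p) / 2 := by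
  have hp0 : 0 < p := by linarith
  have hub : ∀ y : E, 0 ≤ B₂ * ‖y‖ := fun y => (norm_nonneg _).trans (hT 0 y).2
  have hmem : ∀ y n, orbitMean T p n y ^ (1 / p) ∈ Set.Icc (B₁ * ‖y‖) (B₂ * ‖y‖) := by
    intro y n
    have e : ∀ z : ℝ, 0 ≤ z → z = (z ^ p) ^ (1 / p) := fun z hz => by
      rw [one_div, Real.rpow_rpow_inv hz hp0.ne']
    constructor
    · rw [e (B₁ * ‖y‖) (by positivity)]
      exact Real.rpow_le_rpow (by positivity) (le_orbitMean T n y fun j =>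
        Real.rpow_le_rpow (by positivity) (hT j y).1 hp0.le) (by positivity)
    · rw [e (B₂ * ‖y‖) (hub y)]
      exact Real.rpow_le_rpow (orbitMean_nonneg T n y) (orbitMean_le T n y fun j =>
        Real.rpow_le_rpow (norm_nonneg _) (hT j y).2 hp0.le) (by positivity)
  -- Limits along one fixed ultrafilter exist by compactness for every `y` at once, and they
  -- preserve all the closed inequalities satisfied by the means.
  have hlim : ∀ y : E, ∃ l ∈ Set.Icc (B₁ * ‖y‖) (B₂ * ‖y‖),
      Tendsto (fun n => orbitMean T p n y ^ (1 / p)) (hyperfilter ℕ) (𝓝 l) := by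
    intro y
    have := (isCompact_Icc (a := B₁ * ‖y‖) (b := B₂ * ‖y‖)).ultrafilter_le_nhds
      ((hyperfilter ℕ).map fun n => orbitMean T p n y ^ (1 / p))
      (by
        rw [le_principal_iff]
        exact Filter.mem_map.2 (Filter.univ_mem' fun n => hmem y n))
    exact this
  choose N hN hNlim using hlim
  have hN0 : ∀ y, 0 ≤ N y := fun y => le_trans (by positivity) (hN y).1
  have hpow : ∀ y, Tendsto (fun n => orbitMean T p n y) (hyperfilter ℕ) (𝓝 (N y ^ p)) := by
    intro y
    refine ((hNlim y).rpow_const (Or.inr hp0.le)).congr fun n => ?_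
    rw [one_div, Real.rpow_inv_rpow (orbitMean_nonneg T n y) hp0.ne']
  refine ⟨Seminorm.of N ?_ ?_, ?_, hN, ?_⟩
  · intro u v
    exact le_of_tendsto_of_tendsto' (hNlim (u + v)) ((hNlim u).add (hNlim v))
      (fun n => orbitMean_rpow_add_le hp T n u v)
  · intro r y
    refine tendsto_nhds_unique (hNlim (r • y)) (((hNlim y).const_mul ‖r‖).congr fun n => ?_)
    rw [orbitMean_smul, Real.mul_rpow (by positivity) (orbitMean_nonneg T n y), one_div,
      Real.rpow_rpow_inv (norm_nonneg r) hp0.ne']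
  · intro y
    change N (T y) = N y
    -- Shifting the orbit changes only the two end terms, which are bounded, so the means differ by
    -- `O(1 / n)`.
    have hz : Tendsto (fun n => orbitMean T p n (T y) - orbitMean T p n y) (hyperfilter ℕ)
        (𝓝 0) := by
      refine Tendsto.mono_left ?_ Nat.hyperfilter_le_atTop
      have hb : Tendsto (fun n : ℕ => ((B₂ * ‖y‖) ^ p + ‖y‖ ^ p) * (1 / ((n : ℝ) + 1))) atTop
          (𝓝 0) := by
        simpa using (tendsto_one_div_add_atTop_nhds_zero_nat (𝕜 := ℝ)).const_mul
          ((B₂ * ‖y‖) ^ p + ‖y‖ ^ p)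
      refine squeeze_zero_norm (fun n => ?_) hb
      rw [orbitMean_map_sub, norm_div, Real.norm_of_nonneg (by positivity : (0 : ℝ) ≤ n + 1),
        mul_one_div]
      refine div_le_div_of_nonneg_right ?_ (by positivity)
      have h1 : ‖(T ^ (n + 1)) y‖ ^ p ≤ (B₂ * ‖y‖) ^ p :=
        Real.rpow_le_rpow (norm_nonneg _) (hT _ y).2 hp0.le
      have h2 : 0 ≤ ‖(T ^ (n + 1)) y‖ ^ p := by positivity
      have h3 : 0 ≤ ‖y‖ ^ p := by positivity
      rw [Real.norm_eq_abs, abs_le]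
      constructor <;> linarith
    have h := tendsto_nhds_unique hz ((hpow (T y)).sub (hpow y))
    have h' : N (T y) ^ p = N y ^ p := by linarith
    exact Real.rpow_left_injOn hp0.ne' (hN0 _) (hN0 _) h'
  · intro c h u v
    exact le_of_tendsto_of_tendsto' ((hpow _).add ((hpow (u - v)).const_mul c))
      (((hpow u).add (hpow v)).div_const 2) (fun n => orbitMean_midpoint_add_le T h n u v)

end InvariantSeminorm

/-! ### Comparing ergodic averages with dyadic ones. -/

section Orbit

variable {E : Type*} [NormedAddCommGroup E] [NormedSpace ℝ E]

/-- The sum `∑_{i < n} T ^ i` as a linear operator. -/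
def orbitSum (T : E →ₗ[ℝ] E) (n : ℕ) : E →ₗ[ℝ] E := ∑ i ∈ Finset.range n, T ^ i

variable (T : E →ₗ[ℝ] E)

theorem orbitSum_apply (n : ℕ) (y : E) :
    orbitSum T n y = ∑ i ∈ Finset.range n, (T ^ i) y := by
  simp [orbitSum, LinearMap.sum_apply]

theorem orbitSum_add_apply (a b : ℕ) (y : E) :
    orbitSum T (a + b) y = orbitSum T a y + (T ^ a) (orbitSum T b y) := by
  simp only [orbitSum_apply, Finset.sum_range_add, map_sum, pow_add, Module.End.mul_apply]

theorem orbitSum_mul_apply (a b : ℕ) (y : E) :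
    orbitSum T (a * b) y = ∑ q ∈ Finset.range b, (T ^ (a * q)) (orbitSum T a y) := by
  induction b with
  | zero => simp [orbitSum_apply]
  | succ b ih => rw [Nat.mul_succ, orbitSum_add_apply, ih, Finset.sum_range_succ]

theorem pow_orbitSum_comm (a b : ℕ) (y : E) :
    (T ^ a) (orbitSum T b y) = orbitSum T b ((T ^ a) y) := by
  rw [orbitSum_apply, orbitSum_apply, map_sum]
  simp only [← Module.End.mul_apply, ← pow_add, add_comm]

/-- Both sides telescope: `(T ^ a - 1) (1 + ⋯ + T ^ (b - 1)) = (1 + ⋯ + T ^ (a - 1)) (T ^ b - 1)`.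
-/
theorem pow_sub_one_orbitSum (a b : ℕ) (y : E) :
    (T ^ a) (orbitSum T b y) - orbitSum T b y = orbitSum T a ((T ^ b) y - y) := by
  have h1 := orbitSum_add_apply T a b y
  have h2 := orbitSum_add_apply T b a y
  rw [add_comm b a, h1] at h2
  rw [map_sub, ← pow_orbitSum_comm]
  have h3 : (T ^ a) (orbitSum T b y)
      = orbitSum T b y + (T ^ b) (orbitSum T a y) - orbitSum T a y :=
    eq_sub_of_add_eq' h2
  rw [h3]
  abel

theorem smul_ergodicAverage {n : ℕ} (hn : 1 ≤ n) (x : E) :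
    (n : ℝ) • ergodicAverage T n x = orbitSum T n x := by
  have : (n : ℝ) ≠ 0 := by positivity
  rw [ergodicAverage, smul_smul, mul_inv_cancel₀ this, one_smul, orbitSum_apply]

/-- The ergodic average of length `2 ^ n`. -/
noncomputable def dyadicAverage (n : ℕ) (x : E) : E := ((2 : ℝ) ^ n)⁻¹ • orbitSum T (2 ^ n) x

theorem ergodicAverage_two_pow (n : ℕ) (x : E) :
    ergodicAverage T (2 ^ n) x = dyadicAverage T n x := by
  rw [ergodicAverage, dyadicAverage, orbitSum_apply]
  norm_cast

theorem smul_dyadicAverage (n : ℕ) (x : E) :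
    ((2 : ℝ) ^ n) • dyadicAverage T n x = orbitSum T (2 ^ n) x := by
  rw [dyadicAverage, smul_smul, mul_inv_cancel₀ (by positivity), one_smul]

theorem dyadicAverage_succ (n : ℕ) (x : E) :
    dyadicAverage T (n + 1) x
      = (2⁻¹ : ℝ) • (dyadicAverage T n x + (T ^ 2 ^ n) (dyadicAverage T n x)) := by
  have h : 2 ^ (n + 1) = 2 ^ n + 2 ^ n := by ring
  rw [dyadicAverage, dyadicAverage, h, orbitSum_add_apply, map_smul, ← smul_add,
    smul_smul, pow_succ, mul_inv, mul_comm (2⁻¹ : ℝ)]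

variable (N : Seminorm ℝ E)

theorem Seminorm.pow_apply_of_isometry (hT : ∀ y, N (T y) = N y) (n : ℕ) (y : E) :
    N ((T ^ n) y) = N y := by
  induction n with
  | zero => simp
  | succ n ih => rw [pow_succ', Module.End.mul_apply, hT, ih]

theorem Seminorm.sum_le {ι : Type*} (s : Finset ι) (f : ι → E) :
    N (∑ i ∈ s, f i) ≤ ∑ i ∈ s, N (f i) := by
  classical
  induction s using Finset.induction_on with
  | empty => simp
  | insert i s hi ih =>
    rw [Finset.sum_insert hi, Finset.sum_insert hi]
    exact (map_add_le_add N _ _).trans (by gcongr)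

/-- Binary expansion of `h`: the orbit splits into pieces of distinct dyadic lengths, and the shifts
in front of them are isometries. -/
theorem Seminorm.orbitSum_le_sum_dyadic (hT : ∀ y, N (T y) = N y) (y : E) {l h : ℕ}
    (hl : h < 2 ^ l) :
    N (orbitSum T h y) ≤ ∑ i ∈ Finset.range l, N (orbitSum T (2 ^ i) y) := by
  induction l generalizing h with
  | zero =>
    have : h = 0 := by simpa using hl
    simp [this, orbitSum_apply]
  | succ l ih =>
    rw [Finset.sum_range_succ]
    by_cases hh : h < 2 ^ l
    · linarith [ih hh, apply_nonneg N (orbitSum T (2 ^ l) y)]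
    · obtain ⟨b, rfl⟩ := Nat.exists_eq_add_of_le (not_lt.1 hh)
      have hb : b < 2 ^ l := by rw [pow_succ] at hl; omega
      rw [orbitSum_add_apply]
      refine (map_add_le_add N _ _).trans ?_
      rw [N.pow_apply_of_isometry T hT]
      linarith [ih hb]

theorem Seminorm.orbitSum_sub_smul_le {z : E} {h : ℕ} {b : ℝ}
    (hb : ∀ j < h, N ((T ^ j) z - z) ≤ b) : N (orbitSum T h z - (h : ℝ) • z) ≤ h * b := by
  have : orbitSum T h z - (h : ℝ) • z = ∑ j ∈ Finset.range h, ((T ^ j) z - z) := by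
    rw [Finset.sum_sub_distrib, ← orbitSum_apply]
    simp [Nat.cast_smul_eq_nsmul]
  rw [this]
  refine (N.sum_le _ _).trans ?_
  have := Finset.sum_le_card_nsmul (Finset.range h) (fun j => N ((T ^ j) z - z)) b
    (fun j hj => hb j (Finset.mem_range.1 hj))
  simpa using this

/-- The size of the difference of consecutive dyadic averages. -/
noncomputable def dyadicIncrement (x : E) (n : ℕ) : ℝ :=
  N (dyadicAverage T n x - dyadicAverage T (n + 1) x)

/-- The convolution of the dyadic increments with a geometric sequence of ratio `1 / √2`. -/
noncomputable def smoothedIncrement (x : E) (n : ℕ) : ℝ :=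
  ∑ r ∈ Finset.range (n + 1), √(2 ^ r / 2 ^ n) * dyadicIncrement T N x r

theorem dyadicIncrement_nonneg (x : E) (n : ℕ) : 0 ≤ dyadicIncrement T N x n := apply_nonneg N _

theorem smoothedIncrement_nonneg (x : E) (n : ℕ) : 0 ≤ smoothedIncrement T N x n :=
  Finset.sum_nonneg fun r _ => mul_nonneg (Real.sqrt_nonneg _) (dyadicIncrement_nonneg T N x r)

theorem dyadicAverage_sub_le (x : E) {i n : ℕ} (hin : i ≤ n) :
    N (dyadicAverage T i x - dyadicAverage T n x)
      ≤ ∑ r ∈ Finset.Ico i n, dyadicIncrement T N x r := by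
  induction n, hin using Nat.le_induction with
  | base => simp
  | succ n hn ih =>
    rw [Finset.sum_Ico_succ_top hn]
    have : dyadicAverage T i x - dyadicAverage T (n + 1) x
        = (dyadicAverage T i x - dyadicAverage T n x)
          + (dyadicAverage T n x - dyadicAverage T (n + 1) x) := by abel
    rw [this]
    exact (map_add_le_add N _ _).trans (by gcongr; exact le_rfl)

theorem dyadicAverage_shift_eq (x : E) (n : ℕ) :
    N ((T ^ 2 ^ n) (dyadicAverage T n x) - dyadicAverage T n x)
      = 2 * dyadicIncrement T N x n := by
  have : (T ^ 2 ^ n) (dyadicAverage T n x) - dyadicAverage T n x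
      = (-2 : ℝ) • (dyadicAverage T n x - dyadicAverage T (n + 1) x) := by
    rw [dyadicAverage_succ]
    module
  rw [this, map_smul_eq_mul, dyadicIncrement]
  norm_num

theorem sum_two_pow_mul_sum_Ico_le {δ : ℕ → ℝ} (hδ : ∀ r, 0 ≤ δ r) (l n : ℕ) :
    ∑ i ∈ Finset.range (l + 1), (2 : ℝ) ^ i * ∑ r ∈ Finset.Ico i (n + 1), δ r
      ≤ 2 * ∑ r ∈ Finset.range (n + 1), 2 ^ min l r * δ r := by
  simp only [Finset.mul_sum]
  rw [Finset.sum_comm' (t' := Finset.range (n + 1)) (s' := fun r => Finset.range (min l r + 1))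
    (by intro i r; simp only [Finset.mem_range, Finset.mem_Ico]; omega)]
  refine Finset.sum_le_sum fun r _ => ?_
  rw [← Finset.sum_mul, geom_sum_eq (by norm_num), ← mul_assoc]
  refine mul_le_mul_of_nonneg_right ?_ (hδ r)
  rw [pow_succ]
  norm_num
  linarith

/-- The minimum of `2 ^ l` and `2 ^ r` is at most their geometric mean. This is where the square
root in the block estimate originates. -/
theorem sqrt_mul_two_pow_min_le {l n r h : ℕ} (hl : 2 ^ l ≤ h) :
    √((h : ℝ) / 2 ^ n) * 2 ^ min l r ≤ h * √(2 ^ r / 2 ^ n) := by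
  have hl' : (2 : ℝ) ^ l ≤ h := by exact_mod_cast hl
  have h1 : ((2 : ℝ) ^ min l r) * 2 ^ min l r ≤ h * 2 ^ r := by
    have a1 : (2 : ℝ) ^ min l r ≤ 2 ^ l := pow_le_pow_right₀ (by norm_num) (min_le_left _ _)
    have a2 : (2 : ℝ) ^ min l r ≤ 2 ^ r := pow_le_pow_right₀ (by norm_num) (min_le_right _ _)
    exact mul_le_mul (a1.trans hl') a2 (by positivity) (by positivity)
  refine (sq_le_sq₀ (by positivity) (by positivity)).1 ?_
  rw [mul_pow, mul_pow, Real.sq_sqrt (by positivity), Real.sq_sqrt (by positivity)]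
  have h2 : (0 : ℝ) < 2 ^ n := by positivity
  calc (h : ℝ) / 2 ^ n * (2 ^ min l r) ^ 2 = h / 2 ^ n * (2 ^ min l r * 2 ^ min l r) := by ring
    _ ≤ h / 2 ^ n * (h * 2 ^ r) := by gcongr
    _ = _ := by ring

theorem sqrt_mul_sum_dyadicIncrement_le (x : E) {l n h : ℕ} (hl : 2 ^ l ≤ h) :
    √((h : ℝ) / 2 ^ n) * ∑ i ∈ Finset.range (l + 1), (2 : ℝ) ^ i *
        ∑ r ∈ Finset.Ico i (n + 1), dyadicIncrement T N x r
      ≤ 2 * h * smoothedIncrement T N x n := by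
  refine (mul_le_mul_of_nonneg_left (sum_two_pow_mul_sum_Ico_le (dyadicIncrement_nonneg T N x) l n)
    (Real.sqrt_nonneg _)).trans ?_
  rw [smoothedIncrement, mul_left_comm, mul_assoc]
  refine mul_le_mul_of_nonneg_left ?_ (by norm_num)
  rw [Finset.mul_sum, Finset.mul_sum]
  refine Finset.sum_le_sum fun r _ => ?_
  rw [← mul_assoc, ← mul_assoc]
  exact mul_le_mul_of_nonneg_right (sqrt_mul_two_pow_min_le hl) (dyadicIncrement_nonneg T N x r)

/-- By `pow_sub_one_orbitSum`, a shift by `a` of a sum of length `2 ^ n` becomes a sum of length `a`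
of a shift by `2 ^ n`. The latter moves `D n` by exactly `2 δ_n`; lower scales in the binary
expansion of `a` cost the intermediate increments. -/
theorem dyadicAverage_pow_sub_le (hT : ∀ y, N (T y) = N y) (x : E) {n a : ℕ} (ha : a ≤ 2 ^ n) :
    N ((T ^ a) (dyadicAverage T n x) - dyadicAverage T n x) ≤ 4 * smoothedIncrement T N x n := by
  have h1 : N (orbitSum T a ((T ^ 2 ^ n) x - x))
      ≤ ∑ i ∈ Finset.range (n + 1), 2 * ((2 : ℝ) ^ i *
        ∑ r ∈ Finset.Ico i (n + 1), dyadicIncrement T N x r) := by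
    have ha' : a < 2 ^ (n + 1) := ha.trans_lt (Nat.pow_lt_pow_right (by norm_num) n.lt_succ_self)
    refine (N.orbitSum_le_sum_dyadic T hT _ ha').trans (Finset.sum_le_sum fun i hi => ?_)
    have hin : i ≤ n := by simpa [Nat.lt_succ_iff] using hi
    rw [map_sub, ← pow_orbitSum_comm, ← smul_dyadicAverage, map_smul, ← smul_sub,
      map_smul_eq_mul, Real.norm_of_nonneg (by positivity), mul_left_comm]
    refine mul_le_mul_of_nonneg_left ?_ (by positivity)
    have e : (T ^ 2 ^ n) (dyadicAverage T i x) - dyadicAverage T i x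
        = (T ^ 2 ^ n) (dyadicAverage T i x - dyadicAverage T n x)
          + ((T ^ 2 ^ n) (dyadicAverage T n x) - dyadicAverage T n x)
          - (dyadicAverage T i x - dyadicAverage T n x) := by
      rw [map_sub]; abel
    rw [e]
    refine (map_sub_le_add N _ _).trans ?_
    have h2 := map_add_le_add N ((T ^ 2 ^ n) (dyadicAverage T i x - dyadicAverage T n x))
      ((T ^ 2 ^ n) (dyadicAverage T n x) - dyadicAverage T n x)
    rw [N.pow_apply_of_isometry T hT, dyadicAverage_shift_eq] at h2
    have h3 := dyadicAverage_sub_le T N x hin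
    rw [Finset.sum_Ico_succ_top hin]
    linarith
  rw [← Finset.mul_sum] at h1
  have h2 := sqrt_mul_sum_dyadicIncrement_le T N x (l := n) (n := n) (h := 2 ^ n) le_rfl
  push_cast at h2
  rw [div_self (by positivity), Real.sqrt_one, one_mul] at h2
  have h3 : (2 : ℝ) ^ n * N ((T ^ a) (dyadicAverage T n x) - dyadicAverage T n x)
      = N (orbitSum T a ((T ^ 2 ^ n) x - x)) := by
    rw [← pow_sub_one_orbitSum, ← smul_dyadicAverage, map_smul, ← smul_sub, map_smul_eq_mul,
      Real.norm_of_nonneg (by positivity)]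
  have h4 : (0 : ℝ) < 2 ^ n := by positivity
  refine le_of_mul_le_mul_left ?_ h4
  rw [h3]
  linarith

/-- A short average may be far from `D n`, but the loss is at most of order `√(2 ^ n / h)`. The sum
over `x - D n` is expanded in binary, and `D n` itself is almost invariant under the shifts
involved. -/
theorem sqrt_mul_ergodicAverage_sub_dyadicAverage_le (hT : ∀ y, N (T y) = N y) (x : E) {n h : ℕ}
    (h1 : 1 ≤ h) (hn : h ≤ 2 ^ n) :
    √((h : ℝ) / 2 ^ n) * N (ergodicAverage T h x - dyadicAverage T n x)
      ≤ 14 * smoothedIncrement T N x n := by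
  set G := smoothedIncrement T N x n with hG
  have hG0 : 0 ≤ G := smoothedIncrement_nonneg T N x n
  set z := dyadicAverage T n x with hz
  set l := Nat.log 2 h with hl
  have hl1 : 2 ^ l ≤ h := Nat.pow_log_le_self 2 (by omega)
  have hl2 : h < 2 ^ (l + 1) := Nat.lt_pow_succ_log_self (by norm_num) h
  have hln : l ≤ n := (Nat.pow_le_pow_iff_right (by norm_num)).1 (hl1.trans hn)
  have hl1' : (2 : ℝ) ^ l ≤ h := by exact_mod_cast hl1
  have hshift : ∀ k ≤ 2 ^ n, N (orbitSum T k z - (k : ℝ) • z) ≤ k * (4 * G) := fun k hk =>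
    N.orbitSum_sub_smul_le T fun j hj => dyadicAverage_pow_sub_le T N hT x (by omega)
  have hA : N (orbitSum T h (x - z))
      ≤ ∑ i ∈ Finset.range (l + 1), (2 : ℝ) ^ i *
          ∑ r ∈ Finset.Ico i (n + 1), dyadicIncrement T N x r + 2 * h * (4 * G) := by
    have hB : ∀ i ∈ Finset.range (l + 1), N (orbitSum T (2 ^ i) (x - z))
        ≤ (2 : ℝ) ^ i * ∑ r ∈ Finset.Ico i (n + 1), dyadicIncrement T N x r
          + 2 ^ i * (4 * G) := by
      intro i hi
      have hin : i ≤ n := (Nat.lt_succ_iff.1 (Finset.mem_range.1 hi)).trans hln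
      have e : orbitSum T (2 ^ i) (x - z) = (2 : ℝ) ^ i • (dyadicAverage T i x - z)
          - (orbitSum T (2 ^ i) z - (2 : ℝ) ^ i • z) := by
        rw [map_sub, ← smul_dyadicAverage T i x, smul_sub]; abel
      rw [e]
      refine (map_sub_le_add N _ _).trans ?_
      have h2 := hshift (2 ^ i) (Nat.pow_le_pow_right (by norm_num) hin)
      push_cast at h2
      rw [map_smul_eq_mul, Real.norm_of_nonneg (by positivity)]
      have h3 : N (dyadicAverage T i x - z)
          ≤ ∑ r ∈ Finset.Ico i (n + 1), dyadicIncrement T N x r := by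
        rw [Finset.sum_Ico_succ_top hin]
        exact (dyadicAverage_sub_le T N x hin).trans
          (le_add_of_nonneg_right (dyadicIncrement_nonneg T N x n))
      gcongr
    refine (N.orbitSum_le_sum_dyadic T hT _ hl2).trans ((Finset.sum_le_sum hB).trans ?_)
    rw [Finset.sum_add_distrib, ← Finset.sum_mul]
    have h4 : ∑ i ∈ Finset.range (l + 1), (2 : ℝ) ^ i ≤ 2 * h := by
      rw [geom_sum_eq (by norm_num), pow_succ]
      norm_num
      linarith
    gcongr
  have hS := sqrt_mul_sum_dyadicIncrement_le T N x (n := n) hl1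
  rw [← hG] at hS
  have hpos : (0 : ℝ) < h := by exact_mod_cast h1
  have hn' : (h : ℝ) ≤ 2 ^ n := by exact_mod_cast hn
  have hsq : √((h : ℝ) / 2 ^ n) ≤ 1 := by
    refine Real.sqrt_le_one.2 ?_
    rwa [div_le_one (by positivity)]
  have hmain : h * N (ergodicAverage T h x - z)
      ≤ N (orbitSum T h (x - z)) + h * (4 * G) := by
    have e : (h : ℝ) • (ergodicAverage T h x - z)
        = orbitSum T h (x - z) + (orbitSum T h z - (h : ℝ) • z) := by
      rw [smul_sub, smul_ergodicAverage T h1, map_sub]; abel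
    have h5 : h * N (ergodicAverage T h x - z) = N ((h : ℝ) • (ergodicAverage T h x - z)) := by
      rw [map_smul_eq_mul, Real.norm_of_nonneg hpos.le]
    rw [h5, e]
    exact (map_add_le_add N _ _).trans (by gcongr; exact hshift h hn)
  refine le_of_mul_le_mul_left ?_ hpos
  have h6 := mul_le_mul_of_nonneg_left (hmain.trans (add_le_add_left hA _))
    (Real.sqrt_nonneg (h / 2 ^ n))
  have h7 : √((h : ℝ) / 2 ^ n) * (12 * (h * G)) ≤ 1 * (12 * (h * G)) := by gcongr
  nlinarith [h6, h7, hS]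

/-- With `h = t - s`, `(s + h) (A_{s+h} x - A_s x) = h (T ^ s A_h x - A_s x)`. The factor `h / (s +
h)` is at most `2 σ ^ 2` with `σ = √(h / 2 ^ m)`; one `σ` pays for the loss in comparing `A_h x`
with the dyadic average, and one remains. -/
theorem ergodicAverage_sub_rpow_le_of_block {p : ℝ} (hp : 2 ≤ p) (hT : ∀ y, N (T y) = N y) (x : E)
    {m s t : ℕ} (hs1 : 1 ≤ s) (hs : 2 ^ m ≤ 2 * s) (hst : s ≤ t) (ht : t ≤ 2 ^ m) :
    N (ergodicAverage T t x - ergodicAverage T s x) ^ p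
      ≤ 92 ^ p * ((t - s : ℝ) * (smoothedIncrement T N x m ^ p / 2 ^ m)) := by
  obtain ⟨h, rfl⟩ := Nat.exists_eq_add_of_le hst
  set G := smoothedIncrement T N x m with hG
  have hG0 : 0 ≤ G := smoothedIncrement_nonneg T N x m
  rcases Nat.eq_zero_or_pos h with rfl | hh
  · simp [Real.zero_rpow (by linarith : p ≠ 0)]
  have hh' : (0 : ℝ) < h := by exact_mod_cast hh
  have hs' : (0 : ℝ) < s := by exact_mod_cast hs1
  have hm' : (0 : ℝ) < 2 ^ m := by positivity
  have hsm : (2 : ℝ) ^ m ≤ 2 * s := by exact_mod_cast hs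
  have htm : (s : ℝ) + h ≤ 2 ^ m := by exact_mod_cast ht
  set σ := √((h : ℝ) / 2 ^ m) with hσ
  have hσ0 : 0 < σ := Real.sqrt_pos.2 (by positivity)
  have hσ2 : σ ^ 2 = h / 2 ^ m := Real.sq_sqrt (by positivity)
  have hσ1 : σ ≤ 1 := by
    refine Real.sqrt_le_one.2 ?_
    rw [div_le_one hm']
    linarith
  set z := dyadicAverage T m x
  have b1 : σ * N (ergodicAverage T h x - z) ≤ 14 * G :=
    sqrt_mul_ergodicAverage_sub_dyadicAverage_le T N hT x hh (by omega)
  have b2 : N ((T ^ s) z - z) ≤ 4 * G := dyadicAverage_pow_sub_le T N hT x (by omega)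
  have b3 : N (ergodicAverage T s x - z) ≤ 28 * G := by
    have h1 := sqrt_mul_ergodicAverage_sub_dyadicAverage_le T N hT x hs1 (n := m) (by omega)
    have h2 : (1 / 2 : ℝ) ≤ √((s : ℝ) / 2 ^ m) := by
      apply Real.le_sqrt_of_sq_le
      rw [le_div_iff₀ hm']
      linarith
    have h3 := mul_le_mul_of_nonneg_right h2 (apply_nonneg N (ergodicAverage T s x - z))
    linarith
  have b4 : N ((T ^ s) (ergodicAverage T h x) - ergodicAverage T s x)
      ≤ N (ergodicAverage T h x - z) + 32 * G := by
    have e : (T ^ s) (ergodicAverage T h x) - ergodicAverage T s x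
        = (T ^ s) (ergodicAverage T h x - z) + ((T ^ s) z - z) - (ergodicAverage T s x - z) := by
      rw [map_sub]; abel
    rw [e]
    refine (map_sub_le_add N _ _).trans ?_
    have h2 := map_add_le_add N ((T ^ s) (ergodicAverage T h x - z)) ((T ^ s) z - z)
    rw [N.pow_apply_of_isometry T hT] at h2
    linarith
  have b5 : (s + h : ℝ) * N (ergodicAverage T (s + h) x - ergodicAverage T s x)
      = h * N ((T ^ s) (ergodicAverage T h x) - ergodicAverage T s x) := by
    have e : ((s + h : ℕ) : ℝ) • (ergodicAverage T (s + h) x - ergodicAverage T s x)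
        = (h : ℝ) • ((T ^ s) (ergodicAverage T h x) - ergodicAverage T s x) := by
      rw [smul_sub, smul_ergodicAverage T (by omega), orbitSum_add_apply, smul_sub, ← map_smul,
        smul_ergodicAverage T hh, ← smul_ergodicAverage T hs1]
      push_cast
      module
    have e2 := congrArg N e
    rw [map_smul_eq_mul, map_smul_eq_mul, Real.norm_of_nonneg (by positivity),
      Real.norm_of_nonneg (by positivity)] at e2
    push_cast at e2
    exact e2
  have b6 : N (ergodicAverage T (s + h) x - ergodicAverage T s x) ≤ 92 * (σ * G) := by
    set d := N (ergodicAverage T (s + h) x - ergodicAverage T s x)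
    have hd : 0 ≤ d := apply_nonneg N _
    have c1 : σ * N ((T ^ s) (ergodicAverage T h x) - ergodicAverage T s x) ≤ 46 * G := by
      have := mul_le_mul_of_nonneg_left b4 hσ0.le
      have h9 : σ * (32 * G) ≤ 1 * (32 * G) := by gcongr
      linarith
    have c2 : (2 : ℝ) ^ m / 2 * d
        ≤ h * N ((T ^ s) (ergodicAverage T h x) - ergodicAverage T s x) := by
      rw [← b5]
      gcongr
      linarith
    have c3 : (h : ℝ) = σ * σ * 2 ^ m := by
      rw [← sq, hσ2]
      field_simp
    have c4 : (2 : ℝ) ^ m / 2 * d ≤ 2 ^ m / 2 * (92 * (σ * G)) := by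
      have := mul_le_mul_of_nonneg_left c1 (by positivity : 0 ≤ σ * 2 ^ m)
      calc _ ≤ _ := c2
        _ = σ * 2 ^ m * (σ * N ((T ^ s) (ergodicAverage T h x) - ergodicAverage T s x)) := by
          nth_rewrite 1 [c3]; ring
        _ ≤ _ := this
        _ = _ := by ring
    exact le_of_mul_le_mul_left c4 (by positivity)
  -- Here `p ≥ 2` turns the square root into a bound that is additive over intervals.
  have b7 : σ ^ p ≤ h / 2 ^ m := by
    rw [← hσ2, ← Real.rpow_natCast]
    exact Real.rpow_le_rpow_of_exponent_ge hσ0 hσ1 (by exact_mod_cast hp)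
  calc N (ergodicAverage T (s + h) x - ergodicAverage T s x) ^ p ≤ (92 * (σ * G)) ^ p :=
        Real.rpow_le_rpow (apply_nonneg N _) b6 (by linarith)
    _ = 92 ^ p * (σ ^ p * G ^ p) := by
        rw [Real.mul_rpow (by norm_num) (by positivity), Real.mul_rpow hσ0.le hG0]
    _ ≤ 92 ^ p * (h / 2 ^ m * G ^ p) := by gcongr
    _ = _ := by push_cast; ring

end Orbit

/-! ### Energy decay, the clock, and telescoping. -/

section Variation

variable {E : Type*} [NormedAddCommGroup E] [NormedSpace ℝ E]
  (T : E →ₗ[ℝ] E) (N : Seminorm ℝ E) {p c : ℝ}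

theorem dyadicAverage_zero (x : E) : dyadicAverage T 0 x = x := by
  simp [dyadicAverage, orbitSum_apply]

/-- The two points whose midpoint is the next dyadic average have equal `N` by invariance. -/
theorem dyadicAverage_rpow_succ_add_le (hp : 2 ≤ p) (hc : 0 < c) (hT : ∀ y, N (T y) = N y)
    (huc : ∀ u v : E, N ((2⁻¹ : ℝ) • (u + v)) ^ p + c * N (u - v) ^ p ≤ (N u ^ p + N v ^ p) / 2)
    (x : E) (n : ℕ) :
    N (dyadicAverage T (n + 1) x) ^ p + c * dyadicIncrement T N x n ^ p
      ≤ N (dyadicAverage T n x) ^ p := by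
  have h := huc (dyadicAverage T n x) ((T ^ 2 ^ n) (dyadicAverage T n x))
  rw [← dyadicAverage_succ, N.pow_apply_of_isometry T hT, map_sub_rev, dyadicAverage_shift_eq] at h
  have hδ := dyadicIncrement_nonneg T N x n
  have h2 : dyadicIncrement T N x n ^ p ≤ (2 * dyadicIncrement T N x n) ^ p :=
    Real.rpow_le_rpow hδ (by linarith) (by linarith)
  have h3 := mul_le_mul_of_nonneg_left h2 hc.le
  linarith

theorem antitone_dyadicAverage_rpow (hp : 2 ≤ p) (hc : 0 < c) (hT : ∀ y, N (T y) = N y)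
    (huc : ∀ u v : E, N ((2⁻¹ : ℝ) • (u + v)) ^ p + c * N (u - v) ^ p ≤ (N u ^ p + N v ^ p) / 2)
    (x : E) : Antitone fun n => N (dyadicAverage T n x) ^ p := by
  refine antitone_nat_of_succ_le fun n => ?_
  have h := dyadicAverage_rpow_succ_add_le T N hp hc hT huc x n
  have h1 : 0 ≤ c * dyadicIncrement T N x n ^ p :=
    mul_nonneg hc.le (Real.rpow_nonneg (dyadicIncrement_nonneg T N x n) _)
  linarith

theorem sum_dyadicIncrement_rpow_le (hp : 2 ≤ p) (hc : 0 < c) (hT : ∀ y, N (T y) = N y)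
    (huc : ∀ u v : E, N ((2⁻¹ : ℝ) • (u + v)) ^ p + c * N (u - v) ^ p ≤ (N u ^ p + N v ^ p) / 2)
    (x : E) (M : ℕ) :
    ∑ n ∈ Finset.range M, dyadicIncrement T N x n ^ p ≤ N x ^ p / c := by
  have h : ∀ M, c * ∑ n ∈ Finset.range M, dyadicIncrement T N x n ^ p
      ≤ N x ^ p - N (dyadicAverage T M x) ^ p := by
    intro M
    induction M with
    | zero => simp [dyadicAverage_zero]
    | succ M ih =>
      rw [Finset.sum_range_succ, mul_add]
      linarith [dyadicAverage_rpow_succ_add_le T N hp hc hT huc x M]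
  rw [le_div_iff₀ hc, mul_comm]
  have h1 : 0 ≤ N (dyadicAverage T M x) ^ p := Real.rpow_nonneg (apply_nonneg N _) _
  linarith [h M]

/-- `1 / √2 ≤ 3 / 4`, a rational ratio whose geometric series sums to `4`. -/
theorem sqrt_two_pow_div_le {r n : ℕ} (h : r ≤ n) :
    √((2 : ℝ) ^ r / 2 ^ n) ≤ (3 / 4) ^ (n - r) := by
  obtain ⟨k, rfl⟩ := Nat.exists_eq_add_of_le h
  rw [Nat.add_sub_cancel_left]
  apply Real.sqrt_le_iff.2 ⟨by positivity, ?_⟩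
  have h1 : (2 : ℝ) ^ r / 2 ^ (r + k) = (1 / 2) ^ k := by
    rw [pow_add, one_div, inv_pow]
    field_simp
  rw [h1, ← pow_mul, mul_comm, pow_mul]
  exact pow_le_pow_left₀ (by norm_num) (by norm_num) _

theorem sum_range_three_quarters_le (k : ℕ) : ∑ i ∈ Finset.range k, (3 / 4 : ℝ) ^ i ≤ 4 := by
  rw [geom_sum_eq (by norm_num)]
  have : (0 : ℝ) ≤ (3 / 4) ^ k := by positivity
  rw [div_le_iff_of_neg (by norm_num)]
  linarith

/-- Weighted Hölder inequality, with total weight at most `4`. -/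
theorem smoothedIncrement_rpow_le (hp : 2 ≤ p) (x : E) (n : ℕ) :
    smoothedIncrement T N x n ^ p ≤ 4 ^ (p - 1) *
      ∑ r ∈ Finset.range (n + 1), (3 / 4) ^ (n - r) * dyadicIncrement T N x r ^ p := by
  have hδ := dyadicIncrement_nonneg T N x
  set W := ∑ r ∈ Finset.range (n + 1), (3 / 4 : ℝ) ^ (n - r) with hW
  have hW4 : W ≤ 4 := by
    have h := Finset.sum_range_reflect (fun k => (3 / 4 : ℝ) ^ k) (n + 1)
    simp only [Nat.add_sub_cancel] at h
    rw [hW, h]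
    exact sum_range_three_quarters_le _
  set Q := ∑ r ∈ Finset.range (n + 1), (3 / 4 : ℝ) ^ (n - r) * dyadicIncrement T N x r ^ p
  have hW0 : 0 ≤ W := Finset.sum_nonneg fun _ _ => by positivity
  have hQ0 : 0 ≤ Q := Finset.sum_nonneg fun r _ =>
    mul_nonneg (by positivity) (Real.rpow_nonneg (hδ r) _)
  have h1 : smoothedIncrement T N x n ≤ W ^ (1 - p⁻¹) * Q ^ p⁻¹ := by
    refine le_trans (Finset.sum_le_sum fun r hr => ?_) (Real.inner_le_weight_mul_Lp_of_nonneg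
      (Finset.range (n + 1)) (by linarith) (fun r => (3 / 4 : ℝ) ^ (n - r))
      (dyadicIncrement T N x) (fun _ => by positivity) hδ)
    exact mul_le_mul_of_nonneg_right
      (sqrt_two_pow_div_le (Nat.lt_succ_iff.1 (Finset.mem_range.1 hr))) (hδ r)
  have hp0 : p ≠ 0 := by linarith
  calc smoothedIncrement T N x n ^ p ≤ (W ^ (1 - p⁻¹) * Q ^ p⁻¹) ^ p :=
        Real.rpow_le_rpow (smoothedIncrement_nonneg T N x n) h1 (by linarith)
    _ = W ^ (p - 1) * Q := by
        rw [Real.mul_rpow (by positivity) (by positivity), Real.rpow_inv_rpow hQ0 hp0,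
          ← Real.rpow_mul hW0, sub_mul, inv_mul_cancel₀ hp0, one_mul]
    _ ≤ _ := mul_le_mul_of_nonneg_right (Real.rpow_le_rpow hW0 hW4 (by linarith)) hQ0

theorem sum_smoothedIncrement_rpow_le (hp : 2 ≤ p) (x : E) (M : ℕ) :
    ∑ n ∈ Finset.range M, smoothedIncrement T N x n ^ p
      ≤ 4 ^ p * ∑ r ∈ Finset.range M, dyadicIncrement T N x r ^ p := by
  refine (Finset.sum_le_sum fun n _ => smoothedIncrement_rpow_le T N hp x n).trans ?_
  rw [← Finset.mul_sum, Finset.sum_comm' (t' := Finset.range M) (s' := fun r => Finset.Ico r M)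
    (by intro n r; simp only [Finset.mem_range, Finset.mem_Ico]; omega)]
  have h4 : (4 : ℝ) ^ p = 4 ^ (p - 1) * 4 := by
    rw [Real.rpow_sub_one (by norm_num)]
    ring
  rw [h4, mul_assoc]
  refine mul_le_mul_of_nonneg_left ?_ (by positivity)
  rw [Finset.mul_sum]
  refine Finset.sum_le_sum fun r _ => ?_
  rw [← Finset.sum_mul, Finset.sum_Ico_eq_sum_range]
  refine mul_le_mul_of_nonneg_right ?_ (Real.rpow_nonneg (dyadicIncrement_nonneg T N x r) _)
  simp only [Nat.add_sub_cancel_left]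
  exact sum_range_three_quarters_le _

/-- Jensen's inequality with a uniform convexity defect. -/
theorem mean_rpow_add_le_sum (hp : 2 ≤ p)
    (huc : ∀ u v : E, N ((2⁻¹ : ℝ) • (u + v)) ^ p + c * N (u - v) ^ p ≤ (N u ^ p + N v ^ p) / 2)
    {Q : ℕ} (hQ : 1 ≤ Q) (u : ℕ → E) {a : E} (ha : (Q : ℝ) • a = ∑ q ∈ Finset.range Q, u q) :
    Q * N a ^ p + 2 * c * ∑ q ∈ Finset.range Q, N (u q - a) ^ p
      ≤ ∑ q ∈ Finset.range Q, N (u q) ^ p := by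
  have hQ' : (0 : ℝ) < Q := by exact_mod_cast hQ
  -- The midpoints of `u q` and `a` still have mean `a`, so ordinary Jensen applies to them, while
  -- `huc` for each pair supplies the defect.
  have h1 : (Q : ℝ) * N a ≤ ∑ q ∈ Finset.range Q, N ((2⁻¹ : ℝ) • (u q + a)) := by
    have e : (Q : ℝ) • a = ∑ q ∈ Finset.range Q, (2⁻¹ : ℝ) • (u q + a) := by
      rw [← Finset.smul_sum, Finset.sum_add_distrib, ← ha]
      simp only [Finset.sum_const, Finset.card_range, ← Nat.cast_smul_eq_nsmul ℝ]
      module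
    calc (Q : ℝ) * N a = N ((Q : ℝ) • a) := by
          rw [map_smul_eq_mul, Real.norm_of_nonneg hQ'.le]
      _ ≤ _ := by rw [e]; exact N.sum_le _ _
  have h2 : (Q : ℝ) * N a ^ p ≤ ∑ q ∈ Finset.range Q, N ((2⁻¹ : ℝ) • (u q + a)) ^ p := by
    have h3 := Real.rpow_sum_le_const_mul_sum_rpow_of_nonneg (Finset.range Q) (p := p)
      (f := fun q => N ((2⁻¹ : ℝ) • (u q + a))) (by linarith) (fun _ _ => apply_nonneg N _)
    rw [Finset.card_range] at h3
    have h4 := (Real.rpow_le_rpow (by positivity) h1 (by linarith : 0 ≤ p)).trans h3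
    rw [Real.mul_rpow hQ'.le (apply_nonneg N _)] at h4
    refine le_of_mul_le_mul_left ?_ (Real.rpow_pos_of_pos hQ' (p - 1))
    refine le_trans (le_of_eq ?_) h4
    rw [Real.rpow_sub_one hQ'.ne']
    field_simp
  have h5 := Finset.sum_le_sum (s := Finset.range Q) (fun q _ => huc (u q) a)
  rw [Finset.sum_add_distrib, ← Finset.mul_sum, ← Finset.sum_div, Finset.sum_add_distrib,
    Finset.sum_const, Finset.card_range, nsmul_eq_mul] at h5
  linarith

theorem add_rpow_le_two_rpow_mul {a b : ℝ} (hp : 1 ≤ p) (ha : 0 ≤ a) (hb : 0 ≤ b) :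
    (a + b) ^ p ≤ 2 ^ p * (a ^ p + b ^ p) := by
  have h : (a + b) ^ p ≤ 2 ^ (p - 1) * (a ^ p + b ^ p) := by
    lift a to NNReal using ha
    lift b to NNReal using hb
    exact_mod_cast NNReal.rpow_add_le_mul_rpow_add_rpow a b hp
  refine h.trans (mul_le_mul_of_nonneg_right ?_ (by positivity))
  exact Real.rpow_le_rpow_of_exponent_le (by norm_num) (by linarith)

/-- `D j` is the mean of the translates `T ^ (2 ^ i * q) (D i)`, all of equal `N`, so the Jensen
defect is controlled by the energy drop. Replacing a translate of `D i` by `D i` itself costs the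
near-invariance error `4 G_j` of `D j`. -/
theorem dyadicAverage_sub_rpow_le (hp : 2 ≤ p) (hc : 0 < c) (hT : ∀ y, N (T y) = N y)
    (huc : ∀ u v : E, N ((2⁻¹ : ℝ) • (u + v)) ^ p + c * N (u - v) ^ p ≤ (N u ^ p + N v ^ p) / 2)
    (x : E) {i j : ℕ} (hij : i ≤ j) :
    N (dyadicAverage T i x - dyadicAverage T j x) ^ p
      ≤ 2 ^ p * ((N (dyadicAverage T i x) ^ p - N (dyadicAverage T j x) ^ p) / (2 * c)
        + 4 ^ p * smoothedIncrement T N x j ^ p) := by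
  set u := dyadicAverage T i x with hu
  set a := dyadicAverage T j x with ha
  set G := smoothedIncrement T N x j with hG
  have hG0 : 0 ≤ G := smoothedIncrement_nonneg T N x j
  obtain ⟨k, rfl⟩ := Nat.exists_eq_add_of_le hij
  have hmean : ((2 ^ k : ℕ) : ℝ) • a = ∑ q ∈ Finset.range (2 ^ k), (T ^ (2 ^ i * q)) u := by
    simp only [hu, dyadicAverage, map_smul]
    rw [← Finset.smul_sum, ← orbitSum_mul_apply, ← pow_add, ha, dyadicAverage, smul_smul]
    congr 1
    push_cast
    rw [pow_add]
    field_simp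
  have hQ : (0 : ℝ) < ((2 ^ k : ℕ) : ℝ) := by positivity
  have h1 := mean_rpow_add_le_sum N hp huc Nat.one_le_two_pow _ hmean
  simp only [N.pow_apply_of_isometry T hT] at h1
  rw [Finset.sum_const, Finset.card_range, nsmul_eq_mul] at h1
  have h2 : ∀ q ∈ Finset.range (2 ^ k),
      N (u - a) ^ p ≤ 2 ^ p * (N ((T ^ (2 ^ i * q)) u - a) ^ p + 4 ^ p * G ^ p) := by
    intro q hq
    have hq' : 2 ^ i * q ≤ 2 ^ (i + k) := by
      rw [pow_add]
      exact Nat.mul_le_mul_left _ (Finset.mem_range.1 hq).le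
    have h3 := dyadicAverage_pow_sub_le T N hT x hq'
    have h4 : N (u - a) ≤ N ((T ^ (2 ^ i * q)) u - a) + 4 * G := by
      have e : (T ^ (2 ^ i * q)) (u - a)
          = ((T ^ (2 ^ i * q)) u - a) - ((T ^ (2 ^ i * q)) a - a) := by
        rw [map_sub]; abel
      rw [← N.pow_apply_of_isometry T hT (2 ^ i * q) (u - a), e]
      exact (map_sub_le_add N _ _).trans (by gcongr)
    refine (Real.rpow_le_rpow (apply_nonneg N _) h4 (by linarith)).trans ?_
    refine (add_rpow_le_two_rpow_mul (by linarith) (apply_nonneg N _) (by positivity)).trans ?_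
    rw [Real.mul_rpow (by norm_num) hG0]
  have h5 := Finset.sum_le_sum h2
  rw [← Finset.mul_sum, Finset.sum_add_distrib, Finset.sum_const, Finset.sum_const,
    Finset.card_range, nsmul_eq_mul, nsmul_eq_mul] at h5
  set S := ∑ q ∈ Finset.range (2 ^ k), N ((T ^ (2 ^ i * q)) u - a) ^ p
  have h6 : S ≤ ((2 ^ k : ℕ) : ℝ) * ((N u ^ p - N a ^ p) / (2 * c)) := by
    rw [mul_div_assoc', le_div_iff₀ (by positivity)]
    linarith
  refine le_of_mul_le_mul_left (h5.trans ?_) hQ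
  have h7 : (0 : ℝ) ≤ 2 ^ p := by positivity
  nlinarith [mul_le_mul_of_nonneg_left h6 h7]

/-- A monotone clock whose increments dominate the variation within dyadic blocks. -/
noncomputable def variationClock (p : ℝ) (x : E) (t : ℕ) : ℝ :=
  ∑ s ∈ Finset.range t, smoothedIncrement T N x s.size ^ p / 2 ^ s.size

theorem monotone_variationClock (x : E) : Monotone (variationClock T N p x) := by
  refine monotone_nat_of_le_succ fun t => ?_
  rw [variationClock, variationClock, Finset.sum_range_succ]
  exact le_add_of_nonneg_right
    (div_nonneg (Real.rpow_nonneg (smoothedIncrement_nonneg T N x _) _) (by positivity))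

/-- `Nat.size` equals `m` on `[2 ^ (m - 1), 2 ^ m)`, so the clock runs at constant speed on the
block. -/
theorem variationClock_sub_of_block (x : E) {m s t : ℕ} (hs : 2 ^ m ≤ 2 * s) (hst : s ≤ t)
    (ht : t ≤ 2 ^ m) :
    variationClock T N p x t - variationClock T N p x s
      = (t - s : ℝ) * (smoothedIncrement T N x m ^ p / 2 ^ m) := by
  have h : ∀ r ∈ Finset.Ico s t, smoothedIncrement T N x r.size ^ p / 2 ^ r.size
      = smoothedIncrement T N x m ^ p / 2 ^ m := by
    intro r hr
    rw [Finset.mem_Ico] at hr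
    have h1 : r.size ≤ m := Nat.size_le.2 (by omega)
    have h2 : m ≤ r.size := by
      cases m with
      | zero => exact Nat.zero_le _
      | succ k => exact Nat.lt_size.2 (by rw [pow_succ] at hs; omega)
    rw [le_antisymm h1 h2]
  rw [variationClock, variationClock, ← Finset.sum_Ico_eq_sub _ hst, Finset.sum_congr rfl h,
    Finset.sum_const, Nat.card_Ico, nsmul_eq_mul, Nat.cast_sub hst]

theorem variationClock_two_pow_le (x : E) (M : ℕ) :
    variationClock T N p x (2 ^ M)
      ≤ ∑ m ∈ Finset.range (M + 1), smoothedIncrement T N x m ^ p := by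
  induction M with
  | zero => simp [variationClock]
  | succ M ih =>
    have h := variationClock_sub_of_block T N (p := p) x (m := M + 1) (s := 2 ^ M)
      (t := 2 ^ (M + 1)) (by rw [pow_succ]; omega) (Nat.pow_le_pow_right (by norm_num) (by omega))
      le_rfl
    have h0 : 0 ≤ smoothedIncrement T N x (M + 1) ^ p :=
      Real.rpow_nonneg (smoothedIncrement_nonneg T N x _) _
    have h1 : ((2 ^ (M + 1) : ℕ) - (2 ^ M : ℕ) : ℝ)
        * (smoothedIncrement T N x (M + 1) ^ p / 2 ^ (M + 1))
        = smoothedIncrement T N x (M + 1) ^ p / 2 := by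
      push_cast
      rw [pow_succ]
      field_simp
      ring
    rw [h1] at h
    rw [Finset.sum_range_succ]
    linarith

/-- If `s` and `t` lie in different blocks, the path passes through the first power of two above `s`
and the last one not above `t`: two partial blocks and a dyadic jump. Indexing the energy by
`Nat.size` makes it a function of the time alone, so the bound telescopes. -/
theorem ergodicAverage_sub_rpow_le (hp : 2 ≤ p) (hc : 0 < c) (hT : ∀ y, N (T y) = N y)
    (huc : ∀ u v : E, N ((2⁻¹ : ℝ) • (u + v)) ^ p + c * N (u - v) ^ p ≤ (N u ^ p + N v ^ p) / 2)
    (x : E) {s t : ℕ} (hs : 1 ≤ s) (hst : s ≤ t) :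
    N (ergodicAverage T t x - ergodicAverage T s x) ^ p
      ≤ 4 ^ p * (92 ^ p * (variationClock T N p x t - variationClock T N p x s)
        + 2 ^ p / (2 * c) * (N (dyadicAverage T s.size x) ^ p
          - N (dyadicAverage T t.size x) ^ p)) := by
  set Θ := variationClock T N p x
  have hmono : Monotone Θ := monotone_variationClock T N x
  have hanti := antitone_dyadicAverage_rpow T N hp hc hT huc x
  have block : ∀ {m a b : ℕ}, 1 ≤ a → 2 ^ m ≤ 2 * a → a ≤ b → b ≤ 2 ^ m →
      N (ergodicAverage T b x - ergodicAverage T a x) ^ p ≤ 92 ^ p * (Θ b - Θ a) := by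
    intro m a b h1 h2 h3 h4
    rw [variationClock_sub_of_block T N x h2 h3 h4]
    exact ergodicAverage_sub_rpow_le_of_block T N hp hT x h1 h2 h3 h4
  have h4p : (1 : ℝ) ≤ 4 ^ p := Real.one_le_rpow (by norm_num) (by linarith)
  obtain ⟨i, hi⟩ : ∃ i, s.size = i + 1 :=
    Nat.exists_eq_succ_of_ne_zero (Nat.pos_iff_ne_zero.1 (Nat.size_pos.2 hs))
  have hi1 : 2 ^ i ≤ s := Nat.lt_size.1 (by omega)
  have hi2 : s < 2 ^ (i + 1) := Nat.size_le.1 hi.le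
  obtain ⟨j, hj⟩ : ∃ j, t.size = j + 1 :=
    Nat.exists_eq_succ_of_ne_zero (Nat.pos_iff_ne_zero.1 (Nat.size_pos.2 (hs.trans hst)))
  have hj1 : 2 ^ j ≤ t := Nat.lt_size.1 (by omega)
  have hj2 : t < 2 ^ (j + 1) := Nat.size_le.1 hj.le
  have hij : i ≤ j := by
    have := Nat.size_le_size hst
    omega
  rw [hi, hj]
  rcases hij.eq_or_lt with rfl | hlt
  · have h := block (m := i + 1) hs (by rw [pow_succ]; omega) hst hj2.le
    rw [sub_self, mul_zero, add_zero]
    exact h.trans (le_mul_of_one_le_left (mul_nonneg (by positivity) (sub_nonneg.2 (hmono hst))) h4p)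
  · have hA := block (m := i + 1) hs (by rw [pow_succ]; omega) hi2.le le_rfl
    have hC := block (m := j + 1) Nat.one_le_two_pow (by rw [pow_succ]; omega) hj1 hj2.le
    rw [ergodicAverage_two_pow] at hA hC
    have hB : N (dyadicAverage T (i + 1) x - dyadicAverage T j x) ^ p
        ≤ 92 ^ p * (Θ (2 ^ j) - Θ (2 ^ (i + 1))) + 2 ^ p / (2 * c) *
          (N (dyadicAverage T (i + 1) x) ^ p - N (dyadicAverage T j x) ^ p) := by
      rcases (Nat.succ_le_of_lt hlt).eq_or_lt with heq | hlt2
      · rw [Nat.succ_eq_add_one] at heq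
        subst heq
        simp [Real.zero_rpow (by linarith : p ≠ 0)]
      -- The error `G_j ^ p` is paid for by the clock over `[2 ^ (j - 1), 2 ^ j]`, a full block
      -- lying between the two dyadic times since `i + 1 < j`.
      · obtain ⟨k, rfl⟩ : ∃ k, j = k + 1 := ⟨j - 1, by omega⟩
        have h1 := dyadicAverage_sub_rpow_le T N hp hc hT huc x (i := i + 1) (j := k + 1) (by omega)
        have h2 := variationClock_sub_of_block T N (p := p) x (m := k + 1) (s := 2 ^ k)
          (t := 2 ^ (k + 1)) (by rw [pow_succ]; omega)
          (Nat.pow_le_pow_right (by norm_num) (by omega)) le_rfl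
        have h3 : ((2 ^ (k + 1) : ℕ) - (2 ^ k : ℕ) : ℝ)
            * (smoothedIncrement T N x (k + 1) ^ p / 2 ^ (k + 1))
            = smoothedIncrement T N x (k + 1) ^ p / 2 := by
          push_cast
          rw [pow_succ]
          field_simp
          ring
        rw [h3] at h2
        have h4 : Θ (2 ^ (i + 1)) ≤ Θ (2 ^ k) :=
          hmono (Nat.pow_le_pow_right (by norm_num) (by omega))
        have h5 : smoothedIncrement T N x (k + 1) ^ p
            ≤ 2 * (Θ (2 ^ (k + 1)) - Θ (2 ^ (i + 1))) := by linarith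
        have h6 : (2 : ℝ) ^ p * 4 ^ p * 2 ≤ 92 ^ p := by
          have h7 : (2 : ℝ) ≤ 2 ^ p := by
            nth_rewrite 1 [← Real.rpow_one 2]
            exact Real.rpow_le_rpow_of_exponent_le (by norm_num) (by linarith)
          calc (2 : ℝ) ^ p * 4 ^ p * 2 ≤ 2 ^ p * 4 ^ p * 2 ^ p := by gcongr
            _ = 16 ^ p := by
              rw [← Real.mul_rpow (by norm_num) (by norm_num),
                ← Real.mul_rpow (by norm_num) (by norm_num)]
              norm_num
            _ ≤ 92 ^ p := Real.rpow_le_rpow (by norm_num) (by norm_num) (by linarith)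
        have h8 : 0 ≤ Θ (2 ^ (k + 1)) - Θ (2 ^ (i + 1)) :=
          sub_nonneg.2 (hmono (Nat.pow_le_pow_right (by norm_num) (by omega)))
        calc _ ≤ _ := h1
          _ = 2 ^ p * 4 ^ p * smoothedIncrement T N x (k + 1) ^ p + 2 ^ p / (2 * c) *
              (N (dyadicAverage T (i + 1) x) ^ p - N (dyadicAverage T (k + 1) x) ^ p) := by ring
          _ ≤ 2 ^ p * 4 ^ p * (2 * (Θ (2 ^ (k + 1)) - Θ (2 ^ (i + 1)))) + 2 ^ p / (2 * c) *
              (N (dyadicAverage T (i + 1) x) ^ p - N (dyadicAverage T (k + 1) x) ^ p) := by gcongr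
          _ = 2 ^ p * 4 ^ p * 2 * (Θ (2 ^ (k + 1)) - Θ (2 ^ (i + 1))) + 2 ^ p / (2 * c) *
              (N (dyadicAverage T (i + 1) x) ^ p - N (dyadicAverage T (k + 1) x) ^ p) := by ring
          _ ≤ _ := by gcongr
    set α := N (dyadicAverage T (i + 1) x - ergodicAverage T s x)
    set β := N (dyadicAverage T (i + 1) x - dyadicAverage T j x)
    set γ := N (ergodicAverage T t x - dyadicAverage T j x)
    have hα : 0 ≤ α := apply_nonneg N _
    have hβ : 0 ≤ β := apply_nonneg N _
    have hγ : 0 ≤ γ := apply_nonneg N _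
    have htri : N (ergodicAverage T t x - ergodicAverage T s x) ≤ α + (β + γ) := by
      have e : ergodicAverage T t x - ergodicAverage T s x
          = (dyadicAverage T (i + 1) x - ergodicAverage T s x)
            + ((ergodicAverage T t x - dyadicAverage T j x)
              - (dyadicAverage T (i + 1) x - dyadicAverage T j x)) := by abel
      rw [e]
      refine (map_add_le_add N _ _).trans ?_
      have := map_sub_le_add N (ergodicAverage T t x - dyadicAverage T j x)
        (dyadicAverage T (i + 1) x - dyadicAverage T j x)
      linarith
    have hsum : N (ergodicAverage T t x - ergodicAverage T s x) ^ p
        ≤ 4 ^ p * (α ^ p + (β ^ p + γ ^ p)) := by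
      have h2p : (1 : ℝ) ≤ 2 ^ p := Real.one_le_rpow (by norm_num) (by linarith)
      have e4 : (4 : ℝ) ^ p = 2 ^ p * 2 ^ p := by
        rw [← Real.mul_rpow (by norm_num) (by norm_num)]; norm_num
      calc _ ≤ (α + (β + γ)) ^ p := Real.rpow_le_rpow (apply_nonneg N _) htri (by linarith)
        _ ≤ 2 ^ p * (α ^ p + (β + γ) ^ p) :=
          add_rpow_le_two_rpow_mul (by linarith) hα (by positivity)
        _ ≤ 2 ^ p * (2 ^ p * α ^ p + 2 ^ p * (β ^ p + γ ^ p)) := by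
          gcongr
          · exact le_mul_of_one_le_left (by positivity) h2p
          · exact add_rpow_le_two_rpow_mul (by linarith) hβ hγ
        _ = _ := by rw [e4]; ring
    refine hsum.trans (mul_le_mul_of_nonneg_left ?_ (by positivity))
    -- The jump ends at `D j`, but `t.size = j + 1`; decreasing energy allows the later index.
    have hF : 2 ^ p / (2 * c) * (N (dyadicAverage T (i + 1) x) ^ p - N (dyadicAverage T j x) ^ p)
        ≤ 2 ^ p / (2 * c) *
          (N (dyadicAverage T (i + 1) x) ^ p - N (dyadicAverage T (j + 1) x) ^ p) := by
      exact mul_le_mul_of_nonneg_left (sub_le_sub_left (hanti (Nat.le_succ j)) _) (by positivity)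
    linarith

theorem sum_ergodicAverage_sub_rpow_le (hp : 2 ≤ p) (hc : 0 < c) (hT : ∀ y, N (T y) = N y)
    (huc : ∀ u v : E, N ((2⁻¹ : ℝ) • (u + v)) ^ p + c * N (u - v) ^ p ≤ (N u ^ p + N v ^ p) / 2)
    (x : E) {t : ℕ → ℕ} (ht : Monotone t) (ht1 : ∀ k, 1 ≤ t k) (M : ℕ) :
    ∑ k ∈ Finset.range M, N (ergodicAverage T (t (k + 1)) x - ergodicAverage T (t k) x) ^ p
      ≤ 4 ^ p * (92 ^ p * (4 ^ p / c) + 2 ^ p / (2 * c)) * N x ^ p := by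
  set H : ℕ → ℝ := fun s => 4 ^ p * (92 ^ p * variationClock T N p x s
    - 2 ^ p / (2 * c) * N (dyadicAverage T s.size x) ^ p) with hH
  have hstep : ∀ k, N (ergodicAverage T (t (k + 1)) x - ergodicAverage T (t k) x) ^ p
      ≤ H (t (k + 1)) - H (t k) := by
    intro k
    refine (ergodicAverage_sub_rpow_le T N hp hc hT huc x (ht1 k) (ht (Nat.le_succ k))).trans
      (le_of_eq ?_)
    simp only [hH]
    ring
  refine (Finset.sum_le_sum fun k _ => hstep k).trans ?_
  rw [Finset.sum_range_sub (fun k => H (t k))]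
  -- `t M < 2 ^ t M` is a crude dyadic bound, harmless because the total clock is bounded uniformly.
  have h1 : variationClock T N p x (t M) ≤ 4 ^ p * (N x ^ p / c) := by
    refine (monotone_variationClock T N x (Nat.lt_two_pow_self (n := t M)).le).trans
      ((variationClock_two_pow_le T N x _).trans
        ((sum_smoothedIncrement_rpow_le T N hp x _).trans ?_))
    gcongr
    exact sum_dyadicIncrement_rpow_le T N hp hc hT huc x _
  have h2 : 0 ≤ variationClock T N p x (t 0) := by
    have := monotone_variationClock T N (p := p) x (Nat.zero_le (t 0))
    simpa [variationClock] using this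
  have h3 : N (dyadicAverage T (t 0).size x) ^ p ≤ N x ^ p := by
    have := antitone_dyadicAverage_rpow T N hp hc hT huc x (Nat.zero_le (t 0).size)
    simpa only [dyadicAverage_zero] using this
  have h4 : 0 ≤ N (dyadicAverage T (t M).size x) ^ p := Real.rpow_nonneg (apply_nonneg N _) _
  calc H (t M) - H (t 0)
      = 4 ^ p * (92 ^ p * (variationClock T N p x (t M) - variationClock T N p x (t 0))
        + 2 ^ p / (2 * c) * (N (dyadicAverage T (t 0).size x) ^ p
          - N (dyadicAverage T (t M).size x) ^ p)) := by simp only [hH]; ring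
    _ ≤ 4 ^ p * (92 ^ p * (4 ^ p * (N x ^ p / c)) + 2 ^ p / (2 * c) * N x ^ p) := by
        gcongr <;> linarith
    _ = _ := by ring

end Variation

/-! ### Back to the original norm and to general scalars. -/

section RestrictScalars

/-- The real constant bounding the `p`-variation of ergodic averages. -/
noncomputable def ergodicVariationConstant (p K B₁ B₂ : ℝ) : ℝ :=
  4 ^ p * (92 ^ p * (4 ^ p / uniformConvexityConstant p K)
    + 2 ^ p / (2 * uniformConvexityConstant p K)) * B₂ ^ p / B₁ ^ p

variable {p K B₁ B₂ : ℝ}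

theorem sum_norm_ergodicAverage_sub_rpow_le {E : Type*} [NormedAddCommGroup E] [NormedSpace ℝ E]
    (hp : 2 ≤ p) (hB₁ : 0 < B₁) (hB₂ : 0 < B₂)
    (hη : IsModulusOfUniformConvexity ℝ E (fun ε => K * ε ^ p)) (T : E →ₗ[ℝ] E)
    (hT : ∀ (n : ℕ) (y : E), B₁ * ‖y‖ ≤ ‖(T ^ n) y‖ ∧ ‖(T ^ n) y‖ ≤ B₂ * ‖y‖)
    (x : E) {t : ℕ → ℕ} (ht : Monotone t) (ht1 : ∀ k, 1 ≤ t k) (M : ℕ) :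
    ∑ k ∈ Finset.range M, ‖ergodicAverage T (t (k + 1)) x - ergodicAverage T (t k) x‖ ^ p
      ≤ ergodicVariationConstant p K B₁ B₂ * ‖x‖ ^ p := by
  obtain ⟨N, hNT, hN, huc⟩ := exists_invariant_seminorm (p := p) (by linarith) hB₁ T hT
  have hc := uniformConvexityConstant_pos (p := p) hη.constant_pos
  have h1 := sum_ergodicAverage_sub_rpow_le T N hp hc hNT
    (huc _ (norm_rpow_midpoint_add_le hp hη)) x ht ht1 M
  have h2 : B₁ ^ p * ∑ k ∈ Finset.range M,
        ‖ergodicAverage T (t (k + 1)) x - ergodicAverage T (t k) x‖ ^ p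
      ≤ ∑ k ∈ Finset.range M,
        N (ergodicAverage T (t (k + 1)) x - ergodicAverage T (t k) x) ^ p := by
    rw [Finset.mul_sum]
    refine Finset.sum_le_sum fun k _ => ?_
    rw [← Real.mul_rpow hB₁.le (norm_nonneg _)]
    exact Real.rpow_le_rpow (by positivity) (hN _).1 (by linarith)
  have h3 : N x ^ p ≤ B₂ ^ p * ‖x‖ ^ p := by
    rw [← Real.mul_rpow hB₂.le (norm_nonneg _)]
    exact Real.rpow_le_rpow (apply_nonneg N _) (hN x).2 (by linarith)
  rw [ergodicVariationConstant, div_mul_eq_mul_div, le_div_iff₀ (by positivity), mul_comm]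
  refine h2.trans (h1.trans ?_)
  rw [mul_assoc _ (B₂ ^ p)]
  gcongr

variable {𝕜 B : Type*} [RCLike 𝕜] [NormedAddCommGroup B] [NormedSpace 𝕜 B] [NormedSpace ℝ B]

theorem IsModulusOfUniformConvexity.restrictScalars {η : ℝ → ℝ}
    (h : IsModulusOfUniformConvexity 𝕜 B η) : IsModulusOfUniformConvexity ℝ B η := by
  intro ε h0 h2
  refine ⟨(h ε h0 h2).1, (h ε h0 h2).2.1, fun x y hx hy hxy => ?_⟩
  have := (h ε h0 h2).2.2 x y hx hy hxy
  rw [norm_smul] at this ⊢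
  simpa using this

variable [IsScalarTower ℝ 𝕜 B]

theorem restrictScalars_pow_apply (T : B →ₗ[𝕜] B) (n : ℕ) (y : B) :
    ((T.restrictScalars ℝ) ^ n) y = (T ^ n) y := by
  induction n with
  | zero => rfl
  | succ n ih => rw [pow_succ', pow_succ', Module.End.mul_apply, Module.End.mul_apply, ih]; rfl

theorem ergodicAverage_restrictScalars (T : B →ₗ[𝕜] B) (n : ℕ) (x : B) :
    ergodicAverage (T.restrictScalars ℝ) n x = ergodicAverage T n x := by
  simp only [ergodicAverage, restrictScalars_pow_apply]
  rw [← algebraMap_smul 𝕜 ((n : ℝ)⁻¹), map_inv₀, map_natCast]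

end RestrictScalars

theorem theorem3 (p K B₁ B₂ : ℝ) (hp : 2 ≤ p) (hB₁ : 0 < B₁) (hB₂ : 0 < B₂) :
    ∃ C : ℝ, ∀ (𝕜 : Type*) [RCLike 𝕜]
      (B : Type*) [NormedAddCommGroup B] [NormedSpace 𝕜 B] [CompleteSpace B],
      IsModulusOfUniformConvexity 𝕜 B (fun ε => K * ε ^ p) →
      ∀ T : B →ₗ[𝕜] B,
        (∀ (n : ℕ) (y : B), B₁ * ‖y‖ ≤ ‖(T ^ n) y‖ ∧ ‖(T ^ n) y‖ ≤ B₂ * ‖y‖) →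
        ∀ (x : B) (t : ℕ → ℕ), Monotone t → (∀ k, 1 ≤ t k) →
          Summable (fun k : ℕ => ‖ergodicAverage T (t (k + 1)) x - ergodicAverage T (t k) x‖ ^ p) ∧
          ∑' k : ℕ, ‖ergodicAverage T (t (k + 1)) x - ergodicAverage T (t k) x‖ ^ p
            ≤ C * ‖x‖ ^ p := by
  refine ⟨ergodicVariationConstant p K B₁ B₂, ?_⟩
  intro 𝕜 _ B _ _ _ hη T hT x t ht ht1
  -- Real scalars suffice: the hypotheses and the averages involve only norms, orbits and rational
  -- multiples.
  let _ : NormedSpace ℝ B := NormedSpace.restrictScalars ℝ 𝕜 B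
  have : IsScalarTower ℝ 𝕜 B := IsScalarTower.of_algebraMap_smul fun _ _ => rfl
  have hsum := sum_norm_ergodicAverage_sub_rpow_le hp hB₁ hB₂ hη.restrictScalars
    (T.restrictScalars ℝ) (fun n y => by rw [restrictScalars_pow_apply]; exact hT n y) x ht ht1
  simp only [ergodicAverage_restrictScalars] at hsum
  have hpos : ∀ k, 0 ≤ ‖ergodicAverage T (t (k + 1)) x - ergodicAverage T (t k) x‖ ^ p :=
    fun k => by positivity
  exact ⟨summable_of_sum_range_le hpos hsum, Real.tsum_le_of_sum_range_le hpos hsum⟩
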